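/- Let $F$ be a free group on a set $X$ of free generators with more than one element, and let $\mathrm{End}(F)$ be the semigroup of all endomorphisms of $F$ under composition. Then every automorphism of $\mathrm{End}(F)$ is inner: for every semigroup automorphism $\Phi$ of $\mathrm{End}(F)$ there is a group automorphism $s$ of $F$ such that $$\Phi(\nu)=s\circ\nu\circ s^{-1}\qquad\text{for every }\nu\in\mathrm{End}(F).$$ -/

import Mathlib

/-- An automorphism `Φ` of the semigroup `End(F)` of all endomorphisms of a group `F` (with
composition as multiplication) is inner if there is an automorphism `s` of `F` such that
`Φ(ν) = s ∘ ν ∘ s⁻¹` for every endomorphism `ν` of `F`. -/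
def IsInnerAutEnd {F : Type*} [Group F] (Φ : Monoid.End F ≃* Monoid.End F) : Prop :=
  ∃ s : F ≃* F, ∀ ν : Monoid.End F, (Φ ν : F → F) = s ∘ ν ∘ s.symm

/-- The endomorphism of a group mapping everything to `1`. -/
def trivialEnd (F : Type*) [Group F] : Monoid.End F := (1 : F →* F)

/-- The conjugation by `g`, as an endomorphism. -/
def conjEnd {F : Type*} [Group F] (g : F) : Monoid.End F := (MulAut.conj g).toMonoidHom

theorem conjEnd_apply {F : Type*} [Group F] (g y : F) : conjEnd g y = g * y * g⁻¹ := rfl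

theorem conjEnd_mul {F : Type*} [Group F] (g h : F) :
    conjEnd (g * h) = conjEnd g * conjEnd h := by
  unfold conjEnd
  rw [map_mul]
  rfl

theorem mul_conjEnd {F : Type*} [Group F] (ν : Monoid.End F) (g : F) :
    ν * conjEnd g = conjEnd (ν g) * ν := by
  apply MonoidHom.ext
  intro y
  change ν (g * y * g⁻¹) = ν g * ν y * (ν g)⁻¹
  simp

namespace FreeGroup

variable {X : Type*}

/-- The endomorphism of a free group given by the images of the generators. -/
def liftEnd (f : X → FreeGroup X) : Monoid.End (FreeGroup X) := FreeGroup.lift f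

@[simp]
theorem liftEnd_of (f : X → FreeGroup X) (x : X) : liftEnd f (of x) = f x :=
  lift_apply_of

theorem end_ext {α β : Monoid.End (FreeGroup X)} (h : ∀ x, α (of x) = β (of x)) : α = β :=
  FreeGroup.ext_hom _ _ h

/-- Repeat every occurrence of the letter `b` (or its inverse) in a word. -/
def doubleWord [DecidableEq X] (b : X) (L : List (X × Bool)) : List (X × Bool) :=
  L.flatMap fun p => if p.1 = b then [p, p] else [p]

/-- The endomorphism of a free group squaring the generator `b` and fixing the other ones. -/
def double [DecidableEq X] (b : X) : Monoid.End (FreeGroup X) :=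
  liftEnd fun x => if x = b then of b ^ 2 else of x

theorem double_mk [DecidableEq X] (b : X) (L : List (X × Bool)) :
    double b (mk L) = mk (doubleWord b L) := by
  induction L with
  | nil => simp [doubleWord, ← one_eq_mk]
  | cons p L ih =>
    have h1 : (mk (p :: L) : FreeGroup X) = mk [p] * mk L := by simp [mul_mk]
    have h2 : doubleWord b (p :: L) = doubleWord b [p] ++ doubleWord b L := by
      simp [doubleWord]
    rw [h1, _root_.map_mul, ih, h2, ← mul_mk]
    congr 1
    obtain ⟨x, e⟩ := p
    change FreeGroup.lift _ _ = _
    rw [lift_mk]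
    by_cases hx : x = b
    · subst hx
      cases e <;> simp [doubleWord, pow_two, of, inv_mk, invRev]
    · cases e <;> simp [doubleWord, hx, of, inv_mk, invRev]

theorem isReduced_doubleWord [DecidableEq X] (b : X) {L : List (X × Bool)} (h : IsReduced L) :
    IsReduced (doubleWord b L) := by
  induction L with
  | nil => simp [doubleWord]
  | cons p L ih =>
    have ih' := ih (h.infix ⟨[p], [], by simp⟩)
    cases L with
    | nil =>
      by_cases hp : p.1 = b <;> simp [doubleWord, hp, IsReduced]
    | cons q L =>
      have hpq : p.1 = q.1 → p.2 = q.2 := by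
        simp only [IsReduced, List.isChain_cons_cons] at h
        exact h.1
      by_cases hp : p.1 = b <;> by_cases hq : q.1 = b <;>
        simp_all [doubleWord, IsReduced]

theorem countP_doubleWord_of_ne [DecidableEq X] (b : X) (L : List (X × Bool)) :
    (doubleWord b L).countP (fun p => p.1 ≠ b) = L.countP (fun p => p.1 ≠ b) := by
  induction L with
  | nil => rfl
  | cons p L ih =>
    have h2 : doubleWord b (p :: L) = doubleWord b [p] ++ doubleWord b L := by
      simp [doubleWord]
    rw [h2, List.countP_append, ih, List.countP_cons]
    by_cases hp : p.1 = b <;> simp [doubleWord, hp, add_comm]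

theorem countP_doubleWord_of_eq [DecidableEq X] (b : X) (L : List (X × Bool)) :
    (doubleWord b L).countP (fun p => p.1 = b) = 2 * L.countP (fun p => p.1 = b) := by
  induction L with
  | nil => rfl
  | cons p L ih =>
    have h2 : doubleWord b (p :: L) = doubleWord b [p] ++ doubleWord b L := by
      simp [doubleWord]
    rw [h2, List.countP_append, ih, List.countP_cons]
    by_cases hp : p.1 = b <;> simp [doubleWord, hp, mul_add, add_comm]

theorem countP_invRev (P : X → Prop) [DecidablePred P] (L : List (X × Bool)) :
    (invRev L).countP (fun p => P p.1) = L.countP (fun p => P p.1) := by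
  simp [invRev, List.countP_map, Function.comp_def]

theorem lift_mk_mem_zpowers {G : Type*} [Group G] (f : X → G) (g : G) (L : List (X × Bool))
    (h : ∀ p ∈ L, f p.1 = g) : FreeGroup.lift f (mk L) ∈ Subgroup.zpowers g := by
  induction L with
  | nil => simp [← one_eq_mk, one_mem]
  | cons p L ih =>
    have h1 : (mk (p :: L) : FreeGroup X) = mk [p] * mk L := by simp [mul_mk]
    rw [h1, _root_.map_mul]
    refine mul_mem ?_ (ih fun q hq => h q (by simp [hq]))
    have := h p (by simp)
    obtain ⟨x, e⟩ := p
    cases e <;> simp_all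

/-- An element whose square is obtained by doubling the letter `b` is a power of `b` conjugated by
an element not involving `b`. -/
theorem exists_conj_of_double_eq_sq [DecidableEq X] {b : X} {w : FreeGroup X}
    (hw : double b w = w ^ 2) :
    ∃ C R : List (X × Bool), w = mk C * mk R * (mk C)⁻¹ ∧ (∀ p ∈ C, p.1 ≠ b) ∧
      ∀ p ∈ R, p.1 = b := by
  set L := w.toWord with hL
  set C := reduceCyclically.conjugator L with hC
  set R := reduceCyclically L with hR
  have hLr : IsReduced L := isReduced_toWord
  have h1 : C ++ R ++ invRev C = L := reduceCyclically.conj_conjugator_reduceCyclically L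
  have h2 : doubleWord b L = C ++ (R ++ R) ++ invRev C := by
    have h := congrArg toWord hw
    rw [toWord_pow, ← hL, reduceCyclically.reduce_flatten_replicate hLr] at h
    rw [← mk_toWord (x := w), ← hL, double_mk, toWord_mk,
      (isReduced_doubleWord b hLr).reduce_eq] at h
    simpa [List.replicate_succ] using h
  have h3 := countP_doubleWord_of_ne b L
  have h4 := countP_doubleWord_of_eq b L
  rw [h2, ← h1] at h3 h4
  simp only [List.countP_append, countP_invRev (fun x => x ≠ b)] at h3
  simp only [List.countP_append, countP_invRev (fun x => x = b)] at h4
  refine ⟨C, R, ?_, ?_, ?_⟩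
  · rw [inv_mk, mul_mk, mul_mk, h1, hL, mk_toWord]
  · have : C.countP (fun p => p.1 = b) = 0 := by omega
    simpa [List.countP_eq_zero] using this
  · have : R.countP (fun p => p.1 ≠ b) = 0 := by omega
    simpa [List.countP_eq_zero] using this

/-- A natural family of endomorphisms of a free group consists of conjugations by powers. -/
theorem exists_conj_zpow_of_natural [Nontrivial X] (q : FreeGroup X → Monoid.End (FreeGroup X))
    (h1 : q 1 = 1)
    (hq : ∀ (μ : Monoid.End (FreeGroup X)) (g y : FreeGroup X), μ (q g y) = q (μ g) (μ y)) :
    ∃ i : ℤ, ∀ g y, q g y = g ^ i * y * (g ^ i)⁻¹ := by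
  classical
  obtain ⟨a, b, hab⟩ := exists_pair_ne X
  have hD : double b (q (of a) (of b)) = (q (of a) (of b)) ^ 2 := by
    rw [hq (double b), ← map_pow]
    simp [double, hab]
  obtain ⟨C, R, hw, hC, hR⟩ := exists_conj_of_double_eq_sq hD
  have key : ∃ i k : ℤ, ∀ g y, q g y = g ^ i * y ^ k * (g ^ i)⁻¹ := by
    let f : X → FreeGroup X := fun x => if x = b then of b else of a
    obtain ⟨i, hi⟩ := lift_mk_mem_zpowers f (of a) C (fun p hp => if_neg (hC p hp))
    obtain ⟨k, hk⟩ := lift_mk_mem_zpowers f (of b) R (fun p hp => if_pos (hR p hp))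
    have hab' : q (of a) (of b) = of a ^ i * of b ^ k * (of a ^ i)⁻¹ := by
      have := hq (liftEnd f) (of a) (of b)
      simp only [liftEnd_of] at this
      rw [show f a = of a from if_neg hab, show f b = of b from if_pos rfl] at this
      simp only at hi hk
      rw [← this, hw, _root_.map_mul, _root_.map_mul, _root_.map_inv]
      change FreeGroup.lift f _ * FreeGroup.lift f _ * (FreeGroup.lift f _)⁻¹ = _
      rw [← hi, ← hk]
    refine ⟨i, k, fun g y => ?_⟩
    have := hq (liftEnd fun x => if x = b then y else g) (of a) (of b)
    rw [hab'] at this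
    simpa [hab] using this.symm
  obtain ⟨i, k, hik⟩ := key
  have hk : ∀ y : FreeGroup X, y ^ k = y := fun y => by
    have := hik 1 y
    rw [h1] at this
    simpa using this.symm
  exact ⟨i, fun g y => by rw [hik, hk]⟩

/-- The centre of a free group of rank at least two is trivial. -/
theorem eq_one_of_forall_commute [Nontrivial X] {z : FreeGroup X} (hz : ∀ y, z * y = y * z) :
    z = 1 := by
  classical
  rw [← toWord_eq_nil_iff]
  by_contra hne
  obtain ⟨M, p, hM⟩ : ∃ M p, z.toWord = M ++ [p] :=
    ⟨_, _, (List.dropLast_append_getLast hne).symm⟩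
  obtain ⟨y, hy⟩ := exists_ne p.1
  have hr : IsReduced (z.toWord ++ [(y, true)]) := by
    have h0 : IsReduced z.toWord := isReduced_toWord
    rw [hM] at h0 ⊢
    refine IsReduced.append_overlap (L₂ := [p]) h0 ?_ (by simp)
    simp [IsReduced, hy.symm]
  have h := congrArg toWord (hz (of y))
  rw [toWord_mul, toWord_mul, toWord_of, hr.reduce_eq, List.singleton_append, reduce.cons,
    reduce_toWord] at h
  cases hz' : z.toWord with
  | nil => exact hne hz'
  | cons c T =>
    rw [hz'] at h
    simp only at h
    split_ifs at h with hc
    · have := congrArg List.length h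
      simp at this
      omega
    · rw [← hz', hM, ← List.cons_append] at h
      have := List.append_inj_right' h (by simp)
      simp at this
      exact hy (by rw [← this])

theorem conjEnd_injective [Nontrivial X] :
    Function.Injective (conjEnd : FreeGroup X → Monoid.End (FreeGroup X)) := by
  intro g h hgh
  have : g⁻¹ * h = 1 := eq_one_of_forall_commute fun y => by
    have := DFunLike.congr_fun hgh y
    simp only [conjEnd_apply] at this
    have h2 : g⁻¹ * (g * y * g⁻¹) * h = g⁻¹ * (h * y * h⁻¹) * h := by rw [this]
    simpa [mul_assoc] using h2.symm
  exact inv_mul_eq_one.mp this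

theorem isUnit_of_of_eq_zpow {a : X} {v : FreeGroup X} {i : ℤ} (h : of a = v ^ i) : IsUnit i := by
  have := congrArg (FreeGroup.lift fun _ : X => Multiplicative.ofAdd (1 : ℤ)) h
  rw [map_zpow, lift_apply_of] at this
  have := congrArg Multiplicative.toAdd this
  simp at this
  exact IsUnit.of_mul_eq_one _ this.symm

end FreeGroup

/-- The point `u` is fixed by `e`, and every element of the group is the value at `u` of exactly one
endomorphism factoring through `e`. -/
structure IsUniversalPoint {F : Type*} [Group F] (e : Monoid.End F) (u : F) : Prop where
  map_eq : e u = u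
  exists_map_eq : ∀ g, ∃ κ : Monoid.End F, κ * e = κ ∧ κ u = g
  mul_eq_mul : ∀ α β : Monoid.End F, α u = β u → α * e = β * e

theorem isUniversalPoint_lift_const {X : Type*} (a : X) :
    IsUniversalPoint (FreeGroup.liftEnd fun _ : X => FreeGroup.of a) (FreeGroup.of a) where
  map_eq := by simp
  exists_map_eq g := by
    refine ⟨FreeGroup.liftEnd fun _ => g, ?_, by simp⟩
    apply FreeGroup.end_ext
    intro x
    simp [Monoid.End.coe_mul]
  mul_eq_mul α β h := by
    apply FreeGroup.end_ext
    intro x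
    simpa [Monoid.End.coe_mul] using h

theorem isUniversalPoint_of_forall_mem_zpowers {F : Type*} [Group F] [IsMulTorsionFree F]
    {e : Monoid.End F} {u : F} (hu : u ≠ 1) (heu : e u = u)
    (he : ∀ y, e y ∈ Subgroup.zpowers u) : IsUniversalPoint e u where
  map_eq := heu
  exists_map_eq g := by
    choose n hn using fun y => Subgroup.mem_zpowers_iff.mp (he y)
    have hinj : Function.Injective fun k : ℤ => u ^ k :=
      injective_zpow_iff_not_isOfFinOrder.mpr (not_isOfFinOrder_of_isMulTorsionFree hu)
    let κ : F →* F := MonoidHom.mk' (fun y => g ^ n y) fun x y => by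
      rw [← zpow_add]
      congr 1
      apply hinj
      simp only [zpow_add, hn, map_mul]
    have hκ : ∀ y, κ y = g ^ n y := fun _ => rfl
    refine ⟨κ, ?_, ?_⟩
    · ext y
      change κ (e y) = κ y
      rw [hκ, hκ]
      congr 1
      apply hinj
      simp only [hn]
      rw [← hn y, map_zpow, heu]
    · change g ^ n u = g
      rw [show n u = 1 from hinj (by simp [hn, heu]), zpow_one]
  mul_eq_mul α β h := by
    ext y
    change α (e y) = β (e y)
    obtain ⟨k, hk⟩ := Subgroup.mem_zpowers_iff.mp (he y)
    rw [← hk, map_zpow, map_zpow, h]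

/-- A nontrivial idempotent endomorphism of a free group whose local monoid is commutative has
infinite cyclic image. -/
theorem exists_isUniversalPoint {F : Type*} [Group F] [IsFreeGroup F] [IsMulTorsionFree F]
    {e : Monoid.End F} (hidem : e * e = e) (hne : e ≠ trivialEnd F)
    (hcomm : ∀ α β : Monoid.End F, e * α * e * (e * β * e) = e * β * e * (e * α * e)) :
    ∃ u, IsUniversalPoint e u := by
  let H : Subgroup F := MonoidHom.range e
  let B := IsFreeGroup.basis H
  have hfix : ∀ h : H, e h = h := by
    rintro ⟨_, y, rfl⟩
    exact DFunLike.congr_fun hidem y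
  have hsub : ∀ i j, B i = B j := by
    let c : IsFreeGroup.Generators H → Monoid.End F := fun k =>
      (H.subtype.comp (B.lift fun _ => B k)).comp (MonoidHom.rangeRestrict e)
    have hc : ∀ k l, c k (B l) = B k := by
      intro k l
      have : MonoidHom.rangeRestrict e (B l : F) = B l := Subtype.ext (hfix (B l))
      change ((B.lift fun _ => B k) (MonoidHom.rangeRestrict e (B l : F)) : F) = B k
      rw [this]
      congr 1
      simp [FreeGroupBasis.lift, B]
    intro i j
    have := DFunLike.congr_fun (hcomm (c i) (c j)) (B i : F)
    simp only [Monoid.End.coe_mul, Function.comp_apply, hfix, hc] at this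
    exact Subtype.ext this
  have hmem : ∀ i, ∀ h : H, h ∈ Subgroup.zpowers (B i) := by
    intro i h
    have : (B.repr.symm : _ →* H) (B.repr h) ∈ Subgroup.zpowers (B i) := by
      generalize B.repr h = x
      induction x using FreeGroup.induction_on with
      | C1 => simp [one_mem]
      | of x =>
        have : (B.repr.symm : _ →* H) (FreeGroup.of x) = B x := rfl
        rw [this, hsub x i]
        exact Subgroup.mem_zpowers _
      | inv_of x hx => rw [map_inv]; exact inv_mem hx
      | mul x y hx hy => rw [map_mul]; exact mul_mem hx hy
    simpa using this
  have hnon : Nonempty (IsFreeGroup.Generators H) := by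
    by_contra hemp
    rw [not_nonempty_iff] at hemp
    apply hne
    have h0 : (MonoidHom.id H) = 1 := B.ext_hom _ _ fun i => hemp.elim i
    ext y
    exact congrArg Subtype.val (DFunLike.congr_fun h0 (MonoidHom.rangeRestrict e y))
  obtain ⟨i⟩ := hnon
  refine ⟨B i, isUniversalPoint_of_forall_mem_zpowers ?_ (hfix _) ?_⟩
  · intro h
    have h' : B i = 1 := Subtype.ext h
    have := congrArg B.repr h'
    rw [FreeGroupBasis.repr_apply_coe, map_one] at this
    exact FreeGroup.of_ne_one i this
  · intro y
    obtain ⟨k, hk⟩ := Subgroup.mem_zpowers_iff.mp (hmem i (MonoidHom.rangeRestrict e y))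
    exact Subgroup.mem_zpowers_iff.mpr ⟨k, congrArg Subtype.val hk⟩

theorem map_trivialEnd {F : Type*} [Group F] (Φ : Monoid.End F ≃* Monoid.End F) :
    Φ (trivialEnd F) = trivialEnd F := by
  have h1 : ∀ ν, trivialEnd F * ν = trivialEnd F := fun ν => rfl
  have h2 : ∀ ν, ν * trivialEnd F = trivialEnd F := fun ν => MonoidHom.ext fun _ => map_one ν
  have := congrArg Φ (h1 (Φ.symm (trivialEnd F)))
  rw [map_mul, MulEquiv.apply_symm_apply] at this
  exact this.symm.trans (h2 _)

/-- Universal points corresponding to each other under an automorphism of `End(F)` provide a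
permutation of `F` inducing this automorphism. -/
theorem IsUniversalPoint.exists_equiv {F : Type*} [Group F] {Φ : Monoid.End F ≃* Monoid.End F}
    {e : Monoid.End F} {a u : F} (ha : IsUniversalPoint e a) (hu : IsUniversalPoint (Φ e) u) :
    ∃ s : F ≃ F, ∀ ν g, Φ ν (s g) = s (ν g) := by
  choose κ hκ hκa using ha.exists_map_eq
  have huniq : ∀ ν, ν * e = ν → κ (ν a) = ν := fun ν hν => by
    rw [← hκ, ha.mul_eq_mul _ ν (hκa _), hν]
  let s : F → F := fun g => Φ (κ g) u
  have hs : Function.Bijective s := by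
    constructor
    · intro g h hgh
      have := hu.mul_eq_mul _ _ hgh
      rw [← map_mul, ← map_mul, hκ, hκ] at this
      rw [← hκa g, ← hκa h, Φ.injective this]
    · intro h
      obtain ⟨ν', hν', hh⟩ := hu.exists_map_eq h
      obtain ⟨ν, rfl⟩ := Φ.surjective ν'
      rw [← map_mul] at hν'
      exact ⟨ν a, by simp only [s]; rw [huniq ν (Φ.injective hν'), hh]⟩
  refine ⟨Equiv.ofBijective s hs, fun ν g => ?_⟩
  have : κ (ν g) = ν * κ g := by
    rw [← huniq (ν * κ g) (by rw [mul_assoc, hκ]), Monoid.End.coe_mul, Function.comp_apply, hκa]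
  change Φ ν (Φ (κ g) u) = Φ (κ (ν g)) u
  rw [this, map_mul]
  rfl

namespace FreeGroup

variable {X : Type*}

theorem exists_equiv_of_mulEquiv_end [Nonempty X]
    (Φ : Monoid.End (FreeGroup X) ≃* Monoid.End (FreeGroup X)) :
    ∃ s : FreeGroup X ≃ FreeGroup X, ∀ ν g, Φ ν (s g) = s (ν g) := by
  classical
  obtain ⟨a⟩ := ‹Nonempty X›
  let e : Monoid.End (FreeGroup X) := liftEnd fun _ => of a
  have ha : IsUniversalPoint e (of a) := isUniversalPoint_lift_const a
  have hidem : e * e = e := end_ext fun x => by simp [e, Monoid.End.coe_mul]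
  have hz : ∀ α : Monoid.End (FreeGroup X), ∃ n : ℤ, (e * α * e) (of a) = of a ^ n := by
    intro α
    obtain ⟨n, hn⟩ := lift_mk_mem_zpowers (fun _ : X => of a) (of a) (α (of a)).toWord
      fun _ _ => rfl
    refine ⟨n, ?_⟩
    rw [mk_toWord] at hn
    simp only [Monoid.End.coe_mul, Function.comp_apply, ha.map_eq]
    exact hn.symm
  have hcomm : ∀ α β : Monoid.End (FreeGroup X),
      e * α * e * (e * β * e) = e * β * e * (e * α * e) := by
    intro α β
    obtain ⟨m, hm⟩ := hz α
    obtain ⟨n, hn⟩ := hz β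
    have h := ha.mul_eq_mul (e * α * e * (e * β * e)) (e * β * e * (e * α * e)) <| by
      change (e * α * e) ((e * β * e) (of a)) = (e * β * e) ((e * α * e) (of a))
      rw [hm, hn, map_zpow, map_zpow, hm, hn, ← zpow_mul, ← zpow_mul, mul_comm]
    simpa only [mul_assoc, hidem] using h
  have hne : e ≠ trivialEnd (FreeGroup X) := fun h => by
    have := ha.map_eq
    rw [h] at this
    exact one_ne_of a this
  obtain ⟨u, hu⟩ := exists_isUniversalPoint (e := Φ e) (by rw [← _root_.map_mul, hidem])
    (fun h => hne (Φ.injective (h.trans (map_trivialEnd Φ).symm)))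
    (fun α' β' => by
      obtain ⟨α, rfl⟩ := Φ.surjective α'
      obtain ⟨β, rfl⟩ := Φ.surjective β'
      simp only [← _root_.map_mul, hcomm])
  exact ha.exists_equiv hu

/-- If `Φ` is induced by the permutation `s`, then it maps the conjugation by `h` to the conjugation
by a fixed power of `s h`. -/
theorem exists_map_conj_eq [Nontrivial X]
    {Φ : Monoid.End (FreeGroup X) ≃* Monoid.End (FreeGroup X)} {s : FreeGroup X ≃ FreeGroup X}
    (hs : ∀ ν g, Φ ν (s g) = s (ν g)) :
    ∃ i : ℤ, ∀ h, Φ (conjEnd h) = conjEnd (s h ^ i) := by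
  have hc1 : conjEnd (1 : FreeGroup X) = 1 := by
    apply MonoidHom.ext
    intro y
    change 1 * y * 1⁻¹ = y
    rw [one_mul, inv_one, mul_one]
  have hs1 : s.symm 1 = 1 := by
    have := hs (trivialEnd _) 1
    rw [map_trivialEnd] at this
    exact s.injective ((s.apply_symm_apply 1).trans this)
  obtain ⟨i, hi⟩ := exists_conj_zpow_of_natural (fun g => Φ (conjEnd (s.symm g)))
    (by rw [hs1, hc1, _root_.map_one]) <| by
      intro μ g y
      obtain ⟨ν, rfl⟩ := Φ.surjective μ
      have h1 : s.symm (Φ ν g) = ν (s.symm g) := by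
        rw [Equiv.symm_apply_eq, ← hs, Equiv.apply_symm_apply]
      have h3 := DFunLike.congr_fun (congrArg Φ (mul_conjEnd ν (s.symm g))) y
      rw [_root_.map_mul, _root_.map_mul] at h3
      rw [h1]
      exact h3
  refine ⟨i, fun h => MonoidHom.ext fun y => ?_⟩
  have := hi (s h) y
  rw [Equiv.symm_apply_apply] at this
  exact this

theorem isInnerAutEnd [Nontrivial X]
    (Φ : Monoid.End (FreeGroup X) ≃* Monoid.End (FreeGroup X)) : IsInnerAutEnd Φ := by
  obtain ⟨s, hs⟩ := exists_equiv_of_mulEquiv_end Φ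
  obtain ⟨i, hi⟩ := exists_map_conj_eq hs
  obtain ⟨j, hj⟩ := exists_map_conj_eq (Φ := Φ.symm) (s := s.symm) fun ν g => by
    rw [Equiv.eq_symm_apply, ← hs, MulEquiv.apply_symm_apply, Equiv.apply_symm_apply]
  have hunit : IsUnit i := by
    obtain ⟨a⟩ : Nonempty X := inferInstance
    have h := congrArg Φ (hj (of a))
    rw [MulEquiv.apply_symm_apply, hi] at h
    exact isUnit_of_of_eq_zpow (conjEnd_injective h)
  have hbij : Function.Bijective fun g => s g ^ i := by
    rcases Int.isUnit_iff.mp hunit with rfl | rfl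
    · simpa using s.bijective
    · simpa [Function.comp_def] using (Equiv.inv (FreeGroup X)).bijective.comp s.bijective
  let t : FreeGroup X →* FreeGroup X := MonoidHom.mk' (fun g => s g ^ i) fun g h => by
    apply conjEnd_injective
    rw [conjEnd_mul, ← hi, ← hi, ← hi, conjEnd_mul, _root_.map_mul]
  refine ⟨MulEquiv.ofBijective t hbij, fun ν => ?_⟩
  rw [← Function.comp_assoc, MulEquiv.eq_comp_symm]
  funext g
  change Φ ν (s g ^ i) = s (ν g) ^ i
  rw [map_zpow, hs]

end FreeGroup

/-- Conjugation by a group isomorphism, as an isomorphism of endomorphism monoids. -/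
def endCongr {F G : Type*} [Group F] [Group G] (e : F ≃* G) :
    Monoid.End F ≃* Monoid.End G where
  toFun ν := (e.toMonoidHom.comp ν).comp e.symm.toMonoidHom
  invFun ν := (e.symm.toMonoidHom.comp ν).comp e.toMonoidHom
  left_inv ν := MonoidHom.ext fun y => by
    change e.symm (e (ν (e.symm (e y)))) = ν y
    simp
  right_inv ν := MonoidHom.ext fun y => by
    change e (e.symm (ν (e (e.symm y)))) = ν y
    simp
  map_mul' ν μ := MonoidHom.ext fun y => by
    change e (ν (μ (e.symm y))) = e (ν (e.symm (e (μ (e.symm y)))))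
    simp

theorem IsInnerAutEnd.of_endCongr {F G : Type*} [Group F] [Group G] (e : F ≃* G)
    {Φ : Monoid.End F ≃* Monoid.End F}
    (h : IsInnerAutEnd (((endCongr e).symm.trans Φ).trans (endCongr e))) : IsInnerAutEnd Φ := by
  obtain ⟨s, hs⟩ := h
  refine ⟨(e.trans s).trans e.symm, fun ν => funext fun y => ?_⟩
  have h1 := congrFun (hs ((endCongr e) ν)) (e y)
  have h2 : ((endCongr e).symm.trans Φ).trans (endCongr e) ((endCongr e) ν) = (endCongr e) (Φ ν) := by
    simp
  rw [h2] at h1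
  have h3 : e (Φ ν (e.symm (e y))) = s (e (ν (e.symm (s.symm (e y))))) := h1
  rw [e.symm_apply_apply] at h3
  change Φ ν y = e.symm (s (e (ν (e.symm (s.symm (e y))))))
  rw [← h3, e.symm_apply_apply]

theorem mainTheorem10 {X F : Type*} [Group F] (basis : FreeGroupBasis X F) [Nontrivial X]
    (Φ : Monoid.End F ≃* Monoid.End F) : IsInnerAutEnd Φ :=
  IsInnerAutEnd.of_endCongr basis.repr (FreeGroup.isInnerAutEnd _)
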